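/- Let $d\ge 2$ be an integer and consider, in the field $\mathbb{Q}((x^{-1}))$ of formal Laurent series in $x^{-1}$, $$f_d(x)=\prod_{t=0}^{\infty}\bigl(1-x^{-d^t}\bigr),\qquad g_d(x)=x^{-d+1}f_d(x),\qquad h_d(x)=x^{-1}f_d(x),\qquad u_d(x)=(1-x^{-1})f_d(x).$$ Every $u\in\mathbb{Q}((x^{-1}))$ has a continued fraction expansion $u=[a_0;a_1,a_2,\dots]$ with $a_i\in\mathbb{Q}[x]$, obtained by the continued fraction algorithm in which the polynomial part of a series plays the role of the integer part. For $n\ge 0$ the $n$-th convergent of $u$ is the rational function $[a_0;a_1,\dots,a_n]=p_{n,u}(x)/q_{n,u}(x)$, where $p_{n,u},q_{n,u}\in\mathbb{Q}[x]$ are coprime (they are determined up to a common non-zero constant factor). Let $m\ge 0$ be an integer. 1. If $m$ is odd, then there exists an integer $t\ge 0$ such that $$\frac{p_{m,g_d}(x)}{q_{m,g_d}(x)}=\frac{p_{t,u_d}(x^d)}{(1+x+\cdots+x^{d-1})\,q_{t,u_d}(x^d)}\qquad\text{and}\qquad (x-1)\nmid p_{t,u_d}(x).$$ 2. If $m$ is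 even, then there exists an integer $t\ge 0$ such that $$\frac{p_{m,g_d}(x)}{q_{m,g_d}(x)}=\frac{(x-1)\,p_{t,h_d}(x^d)}{q_{t,h_d}(x^d)}\qquad\text{and}\qquad (x-1)\nmid q_{t,h_d}(x).$$ -/

import Mathlib

noncomputable section

open Polynomial

namespace ThueMorseCF

/-! ## Laurent series in `x⁻¹`

The field `ℚ((x⁻¹))` is Mathlib's field of Laurent series over `ℚ`, whose variable plays the role
of `x⁻¹`; the coefficient of `x ^ k` in `u` is therefore `u.coeff (-k)`. -/

/-- The field `ℚ((x⁻¹))`. -/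
abbrev Series : Type := LaurentSeries ℚ

/-- The element `x` of `ℚ((x⁻¹))`. -/
def x : Series := HahnSeries.single (-1 : ℤ) (1 : ℚ)

/-- The inclusion of `ℚ[x]` into `ℚ((x⁻¹))`. -/
def ofPoly : ℚ[X] →+* Series := Polynomial.eval₂RingHom HahnSeries.C x

/-- The polynomial part `∑_{i ≥ 0} u_i x ^ i` of a series `u = ∑_{i ≤ N} u_i x ^ i`. -/
def polyPart (u : Series) : ℚ[X] :=
  ∑ i ∈ Finset.range ((-u.order).toNat + 1), Polynomial.monomial i (u.coeff (-(i : ℤ)))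

theorem coeff_polyPart (u : Series) (n : ℕ) :
    (polyPart u).coeff n = u.coeff (-(n : ℤ)) := by
  simp only [polyPart, Polynomial.finsetSum_coeff, Polynomial.coeff_monomial]
  rw [Finset.sum_ite_eq']
  split_ifs with h
  · rfl
  · rw [Finset.mem_range] at h
    exact (HahnSeries.coeff_eq_zero_of_lt_order (by omega)).symm

/-! ## Continued fractions in `ℚ((x⁻¹))` -/

/-- The complete quotients `α₀ = u`, `αₙ₊₁ = 1 / (αₙ - [αₙ])` of `u`, where `[α]` is the polynomial
part of `α`.  When the expansion stops, all further terms are `0`. -/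
def completeQuotient (u : Series) : ℕ → Series
  | 0 => u
  | n + 1 => (completeQuotient u n - ofPoly (polyPart (completeQuotient u n)))⁻¹

/-- The partial quotients `aₙ` of `u`. -/
def partialQuotient (u : Series) (n : ℕ) : ℚ[X] := polyPart (completeQuotient u n)

theorem completeQuotient_succ_eq_zero {u : Series} {n : ℕ} (h : completeQuotient u n = 0) :
    completeQuotient u (n + 1) = 0 := by
  have h0 : polyPart (0 : Series) = 0 := by
    ext k
    simp [coeff_polyPart]
  simp [completeQuotient, h, h0]

open Classical in
/-- The continued fraction `[a₀; a₁, a₂, …]` of `u`, ending after `aₙ` if `αₙ = aₙ`. -/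
def contFract (u : Series) : GenContFract (RatFunc ℚ) where
  h := algebraMap ℚ[X] (RatFunc ℚ) (partialQuotient u 0)
  s := ⟨fun n =>
      if completeQuotient u (n + 1) = 0 then none
      else some ⟨1, algebraMap ℚ[X] (RatFunc ℚ) (partialQuotient u (n + 1))⟩, by
    intro n hn
    by_cases h : completeQuotient u (n + 1) = 0
    · simp [completeQuotient_succ_eq_zero h]
    · simp [h] at hn⟩

/-- The `n`-th convergent `[a₀; a₁, …, aₙ]` of `u`, a rational function.  (If the expansion stops
at `a_N`, the convergents with `n > N` repeat the last one.) -/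
def convergent (u : Series) (n : ℕ) : RatFunc ℚ := (contFract u).convs n

/-- The numerator `p_{n,u}` of the `n`-th convergent in reduced form. -/
def convNum (u : Series) (n : ℕ) : ℚ[X] := (convergent u n).num

/-- The denominator `q_{n,u}` of the `n`-th convergent in reduced form. -/
def convDen (u : Series) (n : ℕ) : ℚ[X] := (convergent u n).denom

/-! ## The generalized Thue–Morse functions -/

open scoped PowerSeries.WithPiTopology in
/-- The infinite product `∏_{t ≥ 0} (1 - y ^ (d ^ t))` in `ℚ[[y]]`, for the topology of
coefficientwise convergence. -/
def thueMorseProd (d : ℕ) : PowerSeries ℚ :=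
  ∏' t : ℕ, (1 - (PowerSeries.X : PowerSeries ℚ) ^ (d ^ t))

open scoped PowerSeries.WithPiTopology in
/-- The infinite product converges. -/
theorem multipliable_thueMorse {d : ℕ} (hd : 2 ≤ d) :
    Multipliable fun t : ℕ => (1 - (PowerSeries.X : PowerSeries ℚ) ^ (d ^ t)) := by
  simp_rw [sub_eq_add_neg]
  apply PowerSeries.WithPiTopology.multipliable_one_add_of_tendsto_order_atTop_nhds_top
  refine ENat.tendsto_nhds_top_iff_natCast_lt.mpr
    fun n => Filter.eventually_atTop.mpr ⟨n, fun t ht => ?_⟩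
  rw [PowerSeries.order_neg, PowerSeries.order_X_pow]
  exact_mod_cast lt_of_le_of_lt ht (Nat.lt_pow_self (by omega))

/-- `f_d = ∏_{t ≥ 0} (1 - x ^ (-d ^ t))` in `ℚ((x⁻¹))`. -/
def f (d : ℕ) : Series := HahnSeries.ofPowerSeries ℤ ℚ (thueMorseProd d)

/-- `g_d = x ^ (-d + 1) f_d`. -/
def g (d : ℕ) : Series := x ^ (-(d : ℤ) + 1) * f d

/-- `h_d = x⁻¹ f_d`. -/
def h (d : ℕ) : Series := x⁻¹ * f d

/-- `u_d = (1 - x⁻¹) f_d`. -/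
def u (d : ℕ) : Series := (1 - x⁻¹) * f d

end ThueMorseCF

end

noncomputable section

open Polynomial

namespace ThueMorseCF

/-! ## Orders of Laurent series -/

/-! The functional equation `f = (1 - x⁻¹) f(x^d)` gives `g = (x - 1) h(x^d)` and `(1 + ⋯ + x^(d-1))
g = u(x^d)`, while `u = (x - 1) h`. Substituting `x ^ d` in a convergent of `h` or `u` therefore
yields a fraction so close to `g` that it is a convergent of `g` by a Legendre-type criterion
(`convergent_eq_of_lt_order`).

The alternation comes from counting degrees. The error of the `m`-th convergent determines the
degree of the `(m+1)`-st denominator (`natDegree_add_order_eq`). Suppose the `m`-th convergent of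
`g` comes from the `t`-th of `h`, with denominator nonzero at `1`. Combine convergents `t` and `t +
1` of `h` so that the denominator vanishes at `1`, and cancel `x - 1`: this is a convergent of `u`
with numerator nonzero at `1` (`exists_convergent_of_not_dvd_convDen`), and its image has exactly
the degree required of convergent `m + 1`. The passage from `u` back to `h` is symmetric
(`exists_convergent_of_not_dvd_convNum`), so induction on `m` starting from the zero convergent
finishes. Irrationality of `f` ensures that no expansion stops. -/

/-- A series is irrational if it is not a quotient of polynomials. -/
def IsIrrational (w : Series) : Prop :=
  ∀ p q : ℚ[X], q ≠ 0 → w * ofPoly q ≠ ofPoly p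

theorem x_pow (n : ℕ) : x ^ n = HahnSeries.single (-(n : ℤ)) (1 : ℚ) := by
  simp [x, HahnSeries.single_pow]

theorem x_ne_zero : x ≠ 0 := HahnSeries.single_ne_zero one_ne_zero

theorem order_x : x.order = -1 := HahnSeries.order_single one_ne_zero

@[simp]
theorem ofPoly_X : ofPoly X = x := by simp [ofPoly]

theorem ofPoly_monomial (n : ℕ) (a : ℚ) :
    ofPoly (monomial n a) = HahnSeries.single (-(n : ℤ)) a := by
  rw [ofPoly, coe_eval₂RingHom, eval₂_monomial, x_pow, HahnSeries.C_apply,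
    HahnSeries.single_mul_single, zero_add, mul_one]

theorem coeff_ofPoly_neg (p : ℚ[X]) (n : ℕ) : (ofPoly p).coeff (-(n : ℤ)) = p.coeff n := by
  induction p using Polynomial.induction_on' with
  | add p q hp hq => simp [hp, hq]
  | monomial k a =>
    rw [ofPoly_monomial, HahnSeries.coeff_single, Polynomial.coeff_monomial]
    simp only [neg_inj, Nat.cast_inj, eq_comm]

theorem ofPoly_injective : Function.Injective ofPoly := by
  intro p q hpq
  ext n
  rw [← coeff_ofPoly_neg, hpq, coeff_ofPoly_neg]

theorem ofPoly_eq_zero {p : ℚ[X]} : ofPoly p = 0 ↔ p = 0 :=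
  map_eq_zero_iff _ ofPoly_injective

theorem ofPoly_ne_zero {p : ℚ[X]} (hp : p ≠ 0) : ofPoly p ≠ 0 := mt ofPoly_eq_zero.1 hp

theorem order_ofPoly {p : ℚ[X]} (hp : p ≠ 0) : (ofPoly p).order = -(p.natDegree : ℤ) := by
  apply le_antisymm
  · apply HahnSeries.order_le_of_coeff_ne_zero
    rw [coeff_ofPoly_neg]
    exact leadingCoeff_ne_zero.2 hp
  · rw [HahnSeries.le_order_iff_forall (ofPoly_ne_zero hp)]
    intro i hi
    obtain ⟨n, rfl⟩ : ∃ n : ℕ, i = -(n : ℤ) := ⟨(-i).toNat, by omega⟩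
    rw [coeff_ofPoly_neg]
    exact coeff_eq_zero_of_natDegree_lt (by omega)

theorem order_inv (w : Series) : (w⁻¹).order = -w.order := by
  rcases eq_or_ne w 0 with rfl | hw
  · simp
  · have := HahnSeries.order_mul hw (inv_ne_zero hw)
    rw [mul_inv_cancel₀ hw, HahnSeries.order_one] at this
    omega

theorem lt_order_add {a b : Series} (hab : a + b ≠ 0) {i : ℤ} (ha : i < a.order)
    (hb : i < b.order) : i < (a + b).order :=
  (lt_min ha hb).trans_le (HahnSeries.min_order_le_order_add hab)

theorem order_sub_polyPart_pos {w : Series} (hw : w - ofPoly (polyPart w) ≠ 0) :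
    0 < (w - ofPoly (polyPart w)).order := by
  rw [← Int.add_one_le_iff, zero_add, HahnSeries.le_order_iff_forall hw]
  intro i hi
  obtain ⟨n, rfl⟩ : ∃ n : ℕ, i = -(n : ℤ) := ⟨(-i).toNat, by omega⟩
  rw [HahnSeries.coeff_sub, coeff_ofPoly_neg, coeff_polyPart, sub_self]

theorem natDegree_polyPart {w : Series} (h0 : w ≠ 0) (hw : w.order ≤ 0) :
    ((polyPart w).natDegree : ℤ) = -w.order := by
  obtain ⟨n, hn⟩ : ∃ n : ℕ, w.order = -(n : ℤ) := ⟨(-w.order).toNat, by omega⟩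
  rw [hn, neg_neg, Nat.cast_inj]
  apply natDegree_eq_of_le_of_coeff_ne_zero
  · rw [natDegree_le_iff_coeff_eq_zero]
    intro k hk
    rw [coeff_polyPart]
    exact HahnSeries.coeff_eq_zero_of_lt_order (by omega)
  · rw [coeff_polyPart, ← hn]
    exact mt HahnSeries.coeff_order_eq_zero.1 h0

theorem polyPart_eq_zero {w : Series} (hw : 0 < w.order) : polyPart w = 0 := by
  ext n
  rw [coeff_polyPart, coeff_zero]
  exact HahnSeries.coeff_eq_zero_of_lt_order (by omega)

/-! ## Continuants -/

/-- The numerators of the convergents of `w` given by the continuant recurrence. -/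
def contNum (w : Series) : ℕ → ℚ[X]
  | 0 => partialQuotient w 0
  | 1 => partialQuotient w 1 * partialQuotient w 0 + 1
  | n + 2 => partialQuotient w (n + 2) * contNum w (n + 1) + contNum w n

/-- The denominators of the convergents of `w` given by the continuant recurrence. -/
def contDen (w : Series) : ℕ → ℚ[X]
  | 0 => 1
  | 1 => partialQuotient w 1
  | n + 2 => partialQuotient w (n + 2) * contDen w (n + 1) + contDen w n

theorem contNum_mul_contDen_sub (w : Series) (n : ℕ) :
    contNum w (n + 1) * contDen w n - contNum w n * contDen w (n + 1) = (-1) ^ n := by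
  induction n with
  | zero => simp only [contNum, contDen]; ring
  | succ n ih =>
    rw [pow_succ, ← ih]
    simp only [contNum, contDen]
    ring

theorem isCoprime_contNum_contDen (w : Series) (n : ℕ) :
    IsCoprime (contNum w n) (contDen w n) := by
  -- The determinant identity, scaled by its own sign, is a Bézout relation.
  refine ⟨-(-1) ^ n * contDen w (n + 1), (-1) ^ n * contNum w (n + 1), ?_⟩
  have h1 : ((-1 : ℚ[X]) ^ n) * (-1) ^ n = 1 := by rw [← mul_pow]; simp
  linear_combination (-1) ^ n * contNum_mul_contDen_sub w n + h1

theorem IsIrrational.sub_ne_zero {w : Series} (hw : IsIrrational w) {q : ℚ[X]} (hq : q ≠ 0)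
    (p : ℚ[X]) : w * ofPoly q - ofPoly p ≠ 0 :=
  _root_.sub_ne_zero.2 (hw p q hq)

theorem IsIrrational.inv_sub {w : Series} (hw : IsIrrational w) (a : ℚ[X]) :
    IsIrrational (w - ofPoly a)⁻¹ := by
  intro p q hq h
  have h0 : w - ofPoly a ≠ 0 := by simpa using hw.sub_ne_zero one_ne_zero a
  have h1 : ofPoly q = (w - ofPoly a) * ofPoly p := by
    rw [← h, mul_inv_cancel_left₀ h0]
  have hp : p ≠ 0 := by
    rintro rfl
    rw [map_zero, mul_zero] at h1
    exact ofPoly_ne_zero hq h1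
  refine hw (q + a * p) p hp ?_
  rw [map_add, map_mul, h1]
  ring

theorem IsIrrational.ne_zero {w : Series} (hw : IsIrrational w) : w ≠ 0 := by
  simpa using hw 0 1 one_ne_zero

theorem IsIrrational.completeQuotient {w : Series} (hw : IsIrrational w) (n : ℕ) :
    IsIrrational (completeQuotient w n) := by
  induction n with
  | zero => exact hw
  | succ n ih => exact ih.inv_sub _

theorem IsIrrational.order_completeQuotient_succ {w : Series} (hw : IsIrrational w) (n : ℕ) :
    (ThueMorseCF.completeQuotient w (n + 1)).order < 0 := by
  rw [ThueMorseCF.completeQuotient, order_inv, neg_lt_zero]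
  apply order_sub_polyPart_pos
  simpa using (hw.completeQuotient n).sub_ne_zero one_ne_zero _

theorem IsIrrational.natDegree_partialQuotient_succ {w : Series} (hw : IsIrrational w) (n : ℕ) :
    ((partialQuotient w (n + 1)).natDegree : ℤ) =
      -(ThueMorseCF.completeQuotient w (n + 1)).order :=
  natDegree_polyPart (hw.completeQuotient _).ne_zero (hw.order_completeQuotient_succ n).le

theorem IsIrrational.natDegree_partialQuotient_pos {w : Series} (hw : IsIrrational w) (n : ℕ) :
    0 < (partialQuotient w (n + 1)).natDegree := by
  have := hw.natDegree_partialQuotient_succ n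
  have := hw.order_completeQuotient_succ n
  omega

/-- Partial quotients after the first have positive degree, so the leading term of the recurrence
dominates. Nonvanishing is carried along because the induction needs it. -/
theorem IsIrrational.natDegree_contDen_succ {w : Series} (hw : IsIrrational w) (n : ℕ) :
    contDen w n ≠ 0 ∧ (contDen w (n + 1)).natDegree =
      (partialQuotient w (n + 1)).natDegree + (contDen w n).natDegree := by
  have ha (n : ℕ) : partialQuotient w (n + 1) ≠ 0 := by
    intro h
    simpa [h] using hw.natDegree_partialQuotient_pos n
  induction n with
  | zero => simp [contDen]
  | succ n ih =>
    have hpos := hw.natDegree_partialQuotient_pos n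
    have hpos' := hw.natDegree_partialQuotient_pos (n + 1)
    have h0 : contDen w (n + 1) ≠ 0 := by
      intro h
      rw [h, natDegree_zero] at ih
      omega
    refine ⟨h0, ?_⟩
    rw [contDen, natDegree_add_eq_left_of_natDegree_lt, natDegree_mul (ha _) h0]
    rw [natDegree_mul (ha _) h0]
    omega

theorem mul_contDen_sub_contNum (w : Series) (hw : IsIrrational w) (n : ℕ) :
    (w * ofPoly (contDen w (n + 1)) - ofPoly (contNum w (n + 1))) * completeQuotient w (n + 2) =
      -(w * ofPoly (contDen w n) - ofPoly (contNum w n)) := by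
  have key (k : ℕ) : completeQuotient w (k + 1) *
      (completeQuotient w k - ofPoly (partialQuotient w k)) = 1 := by
    rw [completeQuotient, partialQuotient, inv_mul_cancel₀]
    simpa using (hw.completeQuotient k).sub_ne_zero one_ne_zero _
  induction n with
  | zero =>
    have h0 := key 0
    have h1 := key 1
    simp only [contDen, contNum, map_add, map_mul, map_one, mul_one]
    rw [show completeQuotient w 0 = w from rfl] at h0
    linear_combination (-(w - ofPoly (partialQuotient w 0))) * h1 +
      completeQuotient w 2 * h0
  | succ n ih =>
    have h2 := key (n + 2)
    simp only [contDen, contNum, map_add, map_mul] at ih ⊢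
    linear_combination (completeQuotient w (n + 3)) * ih -
      (w * ofPoly (contDen w (n + 1)) - ofPoly (contNum w (n + 1))) * h2

/-- Orders are minus degrees. Each step divides the error by `-αₙ₊₂`, which raises its order by `deg
aₙ₊₂`, the same amount by which the denominator degree grows. -/
theorem IsIrrational.order_mul_contDen_sub {w : Series} (hw : IsIrrational w) (n : ℕ) :
    (w * ofPoly (contDen w n) - ofPoly (contNum w n)).order =
      ((contDen w (n + 1)).natDegree : ℤ) := by
  induction n with
  | zero =>
    have := hw.natDegree_partialQuotient_succ 0
    rw [ThueMorseCF.completeQuotient, order_inv, neg_neg] at this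
    simpa [contDen, contNum, partialQuotient, ThueMorseCF.completeQuotient] using this.symm
  | succ n ih =>
    have h := congrArg HahnSeries.order (mul_contDen_sub_contNum w hw n)
    rw [HahnSeries.order_mul (hw.sub_ne_zero (hw.natDegree_contDen_succ _).1 _)
      (hw.completeQuotient _).ne_zero, HahnSeries.order_neg, ih] at h
    have : ((partialQuotient w (n + 2)).natDegree : ℤ) =
      -(ThueMorseCF.completeQuotient w (n + 2)).order := hw.natDegree_partialQuotient_succ (n + 1)
    have : (contDen w (n + 2)).natDegree =
      (partialQuotient w (n + 2)).natDegree + (contDen w (n + 1)).natDegree :=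
      (hw.natDegree_contDen_succ (n + 1)).2
    change _ = ((contDen w (n + 2)).natDegree : ℤ)
    omega

theorem contFract_get? {w : Series} (hw : IsIrrational w) (n : ℕ) :
    (contFract w).s.get? n =
      some ⟨1, algebraMap ℚ[X] (RatFunc ℚ) (partialQuotient w (n + 1))⟩ :=
  if_neg (hw.completeQuotient _).ne_zero

theorem nums_dens_contFract {w : Series} (hw : IsIrrational w) (n : ℕ) :
    ((contFract w).nums n = algebraMap ℚ[X] (RatFunc ℚ) (contNum w n) ∧
      (contFract w).dens n = algebraMap ℚ[X] (RatFunc ℚ) (contDen w n)) := by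
  induction n using Nat.twoStepInduction with
  | zero => simp [contFract, contNum, contDen]
  | one =>
    rw [GenContFract.first_num_eq (contFract_get? hw 0),
      GenContFract.first_den_eq (contFract_get? hw 0)]
    simp [contFract, contNum, contDen]
  | more n ih ih' =>
    rw [GenContFract.nums_recurrence (contFract_get? hw (n + 1)) ih.1 ih'.1,
      GenContFract.dens_recurrence (contFract_get? hw (n + 1)) ih.2 ih'.2]
    simp [contNum, contDen]

theorem convergent_eq_contNum_div_contDen {w : Series} (hw : IsIrrational w) (n : ℕ) :
    convergent w n = algebraMap ℚ[X] (RatFunc ℚ) (contNum w n) /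
      algebraMap ℚ[X] (RatFunc ℚ) (contDen w n) := by
  rw [convergent, GenContFract.conv_eq_num_div_den, (nums_dens_contFract hw n).1,
    (nums_dens_contFract hw n).2]

/-! ## Convergents in reduced form -/

theorem convDen_ne_zero (w : Series) (n : ℕ) : convDen w n ≠ 0 := RatFunc.denom_ne_zero _

theorem isCoprime_convNum_convDen (w : Series) (n : ℕ) :
    IsCoprime (convNum w n) (convDen w n) := RatFunc.isCoprime_num_denom _

/-- Both fractions are reduced, so the denominators divide each other; a scalar remains because
`RatFunc.denom` is monic while the continuants are not normalized. -/
theorem exists_convNum_convDen_eq {w : Series} (hw : IsIrrational w) (n : ℕ) :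
    ∃ c : ℚ, c ≠ 0 ∧ convNum w n = C c * contNum w n ∧ convDen w n = C c * contDen w n := by
  have hQ := (hw.natDegree_contDen_succ n).1
  have heq : convNum w n * contDen w n = contNum w n * convDen w n :=
    (RatFunc.num_mul_eq_mul_denom_iff hQ).2 (convergent_eq_contNum_div_contDen hw n)
  have hdvd : contDen w n ∣ convDen w n :=
    (isCoprime_contNum_contDen w n).symm.dvd_of_dvd_mul_left ⟨_, by rw [← heq, mul_comm]⟩
  have hdvd' : convDen w n ∣ contDen w n :=
    (isCoprime_convNum_convDen w n).symm.dvd_of_dvd_mul_left ⟨_, by rw [heq, mul_comm]⟩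
  obtain ⟨v, hv⟩ := associated_of_dvd_dvd hdvd hdvd'
  obtain ⟨c, hc, hcv⟩ := Polynomial.isUnit_iff.1 v.isUnit
  refine ⟨c, hc.ne_zero, ?_, by rw [← hv, ← hcv, mul_comm]⟩
  apply mul_right_cancel₀ hQ
  rw [heq, ← hv, ← hcv]
  ring

theorem natDegree_convDen {w : Series} (hw : IsIrrational w) (n : ℕ) :
    (convDen w n).natDegree = (contDen w n).natDegree := by
  obtain ⟨c, hc, -, h⟩ := exists_convNum_convDen_eq hw n
  rw [h, natDegree_C_mul hc]

theorem natDegree_convDen_zero {w : Series} (hw : IsIrrational w) :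
    (convDen w 0).natDegree = 0 := by
  simp [natDegree_convDen hw, contDen]

theorem strictMono_natDegree_convDen {w : Series} (hw : IsIrrational w) :
    StrictMono fun n => (convDen w n).natDegree := by
  refine strictMono_nat_of_lt_succ fun n => ?_
  rw [natDegree_convDen hw, natDegree_convDen hw, (hw.natDegree_contDen_succ n).2]
  have := hw.natDegree_partialQuotient_pos n
  omega

theorem order_mul_convDen_sub {w : Series} (hw : IsIrrational w) (n : ℕ) :
    (w * ofPoly (convDen w n) - ofPoly (convNum w n)).order =
      ((convDen w (n + 1)).natDegree : ℤ) := by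
  obtain ⟨c, hc, hn, hd⟩ := exists_convNum_convDen_eq hw n
  rw [natDegree_convDen hw, ← hw.order_mul_contDen_sub n, hn, hd]
  have : w * ofPoly (C c * contDen w n) - ofPoly (C c * contNum w n) =
      ofPoly (C c) * (w * ofPoly (contDen w n) - ofPoly (contNum w n)) := by
    simp only [map_mul]
    ring
  rw [this, HahnSeries.order_mul (ofPoly_ne_zero (C_ne_zero.2 hc))
    (hw.sub_ne_zero (hw.natDegree_contDen_succ _).1 _), order_ofPoly (C_ne_zero.2 hc)]
  simp

theorem convNum_mul_convDen_sub {w : Series} (hw : IsIrrational w) (n : ℕ) :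
    ∃ c : ℚ, c ≠ 0 ∧
      convNum w (n + 1) * convDen w n - convNum w n * convDen w (n + 1) = C c := by
  obtain ⟨a, ha, hna, hda⟩ := exists_convNum_convDen_eq hw n
  obtain ⟨b, hb, hnb, hdb⟩ := exists_convNum_convDen_eq hw (n + 1)
  refine ⟨a * b * (-1) ^ n, by simp [ha, hb], ?_⟩
  rw [hna, hda, hnb, hdb]
  simp only [map_mul, map_pow, map_neg, map_one]
  linear_combination C a * C b * contNum_mul_contDen_sub w n

/-- If `p / q` is so close to `w` that `deg (w q - p) < - deg q`, then it is the convergent of `w`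
singled out by the degree of `q`. -/
theorem convergent_eq_of_lt_order {w : Series} (hw : IsIrrational w) {p q : ℚ[X]} (hq : q ≠ 0)
    (hpq : (q.natDegree : ℤ) < (w * ofPoly q - ofPoly p).order) {n : ℕ}
    (hn : (convDen w n).natDegree ≤ q.natDegree)
    (hn' : q.natDegree < (convDen w (n + 1)).natDegree) :
    convergent w n = algebraMap ℚ[X] (RatFunc ℚ) p / algebraMap ℚ[X] (RatFunc ℚ) q := by
  rw [← RatFunc.num_mul_eq_mul_denom_iff hq]
  change convNum w n * q = p * convDen w n
  rw [← _root_.sub_eq_zero]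
  by_contra hne
  have hd := convDen_ne_zero w n
  -- Both summands on the right have positive order, whereas a nonzero polynomial has order at most
  -- `0`. Coprimality of `p` and `q` plays no role.
  have heq : ofPoly (convNum w n * q - p * convDen w n) =
      ofPoly (convDen w n) * (w * ofPoly q - ofPoly p) +
        (-ofPoly q) * (w * ofPoly (convDen w n) - ofPoly (convNum w n)) := by
    simp only [map_sub, map_mul]
    ring
  have h0 := ofPoly_ne_zero hne
  have h1 := order_ofPoly hne
  rw [heq] at h0 h1
  have h2 := lt_order_add h0 (i := 0)
    (by
      rw [HahnSeries.order_mul (ofPoly_ne_zero hd) (hw.sub_ne_zero hq _), order_ofPoly hd]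
      omega)
    (by
      rw [HahnSeries.order_mul (neg_ne_zero.2 (ofPoly_ne_zero hq)) (hw.sub_ne_zero hd _),
        HahnSeries.order_neg, order_ofPoly hq, order_mul_convDen_sub hw]
      omega)
  omega

/-- A reduced fraction `p / q` with `deg (w q - p) < - deg q` is a convergent of `w` in reduced
form. -/
theorem exists_convNum_convDen_associated {w : Series} (hw : IsIrrational w) {p q : ℚ[X]}
    (hq : q ≠ 0) (hpq : (q.natDegree : ℤ) < (w * ofPoly q - ofPoly p).order)
    (hco : IsCoprime p q) :
    ∃ n, (convDen w n).natDegree = q.natDegree ∧ convNum w n ∣ p ∧ convDen w n ∣ q := by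
  classical
  -- Strictly increasing natural numbers satisfy `k ≤ deg qₖ`; take `k = deg q + 1`.
  have hex : ∃ n, q.natDegree < (convDen w (n + 1)).natDegree :=
    ⟨q.natDegree, (strictMono_natDegree_convDen hw).le_apply⟩
  have hle : (convDen w (Nat.find hex)).natDegree ≤ q.natDegree := by
    rcases hk : Nat.find hex with _ | k
    · rw [natDegree_convDen_zero hw]
      exact Nat.zero_le _
    · exact not_lt.1 (Nat.find_min hex (m := k) (by omega))
  have h := convergent_eq_of_lt_order hw hq hpq hle (Nat.find_spec hex)
  generalize Nat.find hex = n at *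
  have heq : convNum w n * q = p * convDen w n := (RatFunc.num_mul_eq_mul_denom_iff hq).2 h
  have hc := isCoprime_convNum_convDen w n
  refine ⟨n, le_antisymm hle (natDegree_le_of_dvd ?_ (convDen_ne_zero w n)), ?_, ?_⟩
  · exact hco.symm.dvd_of_dvd_mul_left ⟨_, by rw [← heq, mul_comm]⟩
  · exact hc.dvd_of_dvd_mul_right ⟨_, heq.symm⟩
  · exact hc.symm.dvd_of_dvd_mul_left ⟨_, by rw [heq, mul_comm]⟩

/-! ## The substitution `x ↦ x ^ d` -/

/-- The substitution `x ↦ x ^ d` in `ℚ((x⁻¹))`. -/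
def substPow (d : ℕ) (hd : 0 < d) : Series →+* Series :=
  HahnSeries.embDomainRingHom (AddMonoidHom.mulLeft (d : ℤ))
    (mul_right_injective₀ (by omega)) fun _ _ => mul_le_mul_iff_of_pos_left (by omega)

theorem coeff_substPow_mul {d : ℕ} (hd : 0 < d) (w : Series) (i : ℤ) :
    (substPow d hd w).coeff (d * i) = w.coeff i :=
  HahnSeries.embDomain_coeff

theorem coeff_substPow_of_not_dvd {d : ℕ} (hd : 0 < d) (w : Series) {i : ℤ}
    (hi : ¬ (d : ℤ) ∣ i) : (substPow d hd w).coeff i = 0 :=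
  HahnSeries.embDomain_of_notMem_range fun ⟨j, hj⟩ => hi ⟨j, hj.symm⟩

theorem substPow_single {d : ℕ} (hd : 0 < d) (i : ℤ) (a : ℚ) :
    substPow d hd (HahnSeries.single i a) = HahnSeries.single (d * i) a :=
  HahnSeries.embDomain_single

theorem substPow_x {d : ℕ} (hd : 0 < d) : substPow d hd x = x ^ d := by
  rw [x_pow, x, substPow_single, mul_neg_one]

theorem substPow_ofPoly {d : ℕ} (hd : 0 < d) (p : ℚ[X]) :
    substPow d hd (ofPoly p) = ofPoly (expand ℚ d p) := by
  induction p using Polynomial.induction_on' with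
  | add p q hp hq => simp [hp, hq]
  | monomial n a =>
    rw [expand_monomial, ofPoly_monomial, ofPoly_monomial, substPow_single]
    congr 2
    push_cast
    ring

theorem order_substPow {d : ℕ} (hd : 0 < d) {w : Series} (hw : w ≠ 0) :
    (substPow d hd w).order = d * w.order := by
  have h0 : substPow d hd w ≠ 0 := (_root_.map_ne_zero _).2 hw
  apply le_antisymm
  · apply HahnSeries.order_le_of_coeff_ne_zero
    rw [coeff_substPow_mul]
    exact mt HahnSeries.coeff_order_eq_zero.1 hw
  · rw [HahnSeries.le_order_iff_forall h0]
    intro i hi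
    by_cases hdi : (d : ℤ) ∣ i
    · obtain ⟨j, rfl⟩ := hdi
      rw [coeff_substPow_mul]
      exact HahnSeries.coeff_eq_zero_of_lt_order (lt_of_mul_lt_mul_left hi (by omega))
    · exact coeff_substPow_of_not_dvd hd w hdi

theorem coeff_ofPowerSeries_of_neg (φ : PowerSeries ℚ) {i : ℤ} (hi : i < 0) :
    (HahnSeries.ofPowerSeries ℤ ℚ φ).coeff i = 0 := by
  rw [HahnSeries.ofPowerSeries_apply]
  apply HahnSeries.embDomain_of_notMem_range
  rintro ⟨n, hn⟩
  simp at hn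
  omega

theorem substPow_ofPowerSeries {d : ℕ} (hd : 0 < d) (φ : PowerSeries ℚ) :
    substPow d hd (HahnSeries.ofPowerSeries ℤ ℚ φ) =
      HahnSeries.ofPowerSeries ℤ ℚ (PowerSeries.expand d hd.ne' φ) := by
  ext i
  by_cases hdi : (d : ℤ) ∣ i
  · obtain ⟨j, rfl⟩ := hdi
    rw [coeff_substPow_mul]
    rcases lt_or_ge j 0 with hj | hj
    · rw [coeff_ofPowerSeries_of_neg _ hj,
        coeff_ofPowerSeries_of_neg _ (mul_neg_of_pos_of_neg (by omega) hj)]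
    · lift j to ℕ using hj
      rw [← Nat.cast_mul, HahnSeries.ofPowerSeries_apply_coeff,
        HahnSeries.ofPowerSeries_apply_coeff, PowerSeries.coeff_expand_mul]
  · rw [coeff_substPow_of_not_dvd hd _ hdi]
    rcases lt_or_ge i 0 with hi | hi
    · rw [coeff_ofPowerSeries_of_neg _ hi]
    · lift i to ℕ using hi
      rw [HahnSeries.ofPowerSeries_apply_coeff,
        PowerSeries.coeff_expand_of_not_dvd _ _ _ (by exact_mod_cast hdi)]

/-! ## The functional equation and irrationality -/

-- Each coefficient of the image is a coefficient of the argument or `0`. Continuity lets `expand`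
-- pass through the infinite product.
open scoped PowerSeries.WithPiTopology in
theorem continuous_powerSeries_expand {d : ℕ} (hd : d ≠ 0) :
    Continuous (PowerSeries.expand (R := ℚ) d hd) := by
  rw [continuous_iff_continuousAt]
  intro φ
  rw [ContinuousAt, PowerSeries.WithPiTopology.tendsto_iff_coeff_tendsto]
  intro n
  simp only [PowerSeries.coeff_expand]
  split_ifs
  · exact (PowerSeries.WithPiTopology.continuous_coeff ℚ _).tendsto φ
  · exact tendsto_const_nhds

theorem powerSeries_expand_one_sub_X_pow {d : ℕ} (hd : d ≠ 0) (t : ℕ) :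
    PowerSeries.expand d hd (1 - (PowerSeries.X : PowerSeries ℚ) ^ d ^ t) =
      1 - PowerSeries.X ^ d ^ (t + 1) := by
  rw [map_sub, map_one, map_pow, PowerSeries.expand_X, ← pow_mul, pow_succ']

open scoped PowerSeries.WithPiTopology in
theorem hasProd_expand_thueMorseProd {d : ℕ} (hd : 2 ≤ d) (hd0 : d ≠ 0) :
    HasProd (fun t : ℕ => 1 - (PowerSeries.X : PowerSeries ℚ) ^ d ^ (t + 1))
      (PowerSeries.expand d hd0 (thueMorseProd d)) := by
  have h : HasProd (fun t : ℕ => 1 - (PowerSeries.X : PowerSeries ℚ) ^ d ^ t)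
    (thueMorseProd d) := (multipliable_thueMorse hd).hasProd
  simpa only [Function.comp_def, powerSeries_expand_one_sub_X_pow] using h.map
    (PowerSeries.expand (R := ℚ) d hd0) (continuous_powerSeries_expand hd0)

open scoped PowerSeries.WithPiTopology in
theorem thueMorseProd_eq {d : ℕ} (hd : 2 ≤ d) (hd0 : d ≠ 0) :
    thueMorseProd d = (1 - PowerSeries.X) * PowerSeries.expand d hd0 (thueMorseProd d) := by
  have hprod := hasProd_expand_thueMorseProd hd hd0
  have h := tprod_eq_zero_mul' (f := fun t : ℕ => 1 - (PowerSeries.X : PowerSeries ℚ) ^ d ^ t)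
    hprod.multipliable
  rw [hprod.tprod_eq, pow_zero, pow_one] at h
  exact h

open scoped PowerSeries.WithPiTopology in
theorem constantCoeff_thueMorseProd {d : ℕ} (hd : 2 ≤ d) :
    PowerSeries.constantCoeff (thueMorseProd d) = 1 := by
  rw [thueMorseProd, (multipliable_thueMorse hd).map_tprod (PowerSeries.constantCoeff (R := ℚ))
    (PowerSeries.WithPiTopology.continuous_constantCoeff ℚ)]
  have h (t : ℕ) : PowerSeries.constantCoeff (1 - (PowerSeries.X : PowerSeries ℚ) ^ d ^ t) = 1 := by
    rw [map_sub, map_one, map_pow, PowerSeries.constantCoeff_X,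
      zero_pow (pow_ne_zero _ (by omega)), sub_zero]
  simp only [h, tprod_one]

theorem coeff_f_zero {d : ℕ} (hd : 2 ≤ d) : (f d).coeff 0 = 1 := by
  have := HahnSeries.ofPowerSeries_apply_coeff (Γ := ℤ) (thueMorseProd d) 0
  rw [f, ← Nat.cast_zero, this, PowerSeries.coeff_zero_eq_constantCoeff,
    constantCoeff_thueMorseProd hd]

theorem f_ne_zero {d : ℕ} (hd : 2 ≤ d) : f d ≠ 0 := by
  intro h
  simpa [h] using coeff_f_zero hd

theorem order_f {d : ℕ} (hd : 2 ≤ d) : (f d).order = 0 := by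
  apply le_antisymm
  · apply HahnSeries.order_le_of_coeff_ne_zero
    simp [coeff_f_zero hd]
  · rw [HahnSeries.le_order_iff_forall (f_ne_zero hd)]
    intro i hi
    exact coeff_ofPowerSeries_of_neg _ hi

theorem f_eq {d : ℕ} (hd : 2 ≤ d) :
    f d = (1 - x⁻¹) * substPow d (by omega) (f d) := by
  have hX : HahnSeries.ofPowerSeries ℤ ℚ PowerSeries.X = x⁻¹ := by
    rw [HahnSeries.ofPowerSeries_X, x, HahnSeries.inv_single, neg_neg, inv_one]
  conv_lhs => rw [f, thueMorseProd_eq hd (by omega)]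
  rw [map_mul, map_sub, map_one, hX, f, substPow_ofPowerSeries]

theorem x_mul_f {d : ℕ} (hd : 2 ≤ d) :
    x * f d = (x - 1) * substPow d (by omega) (f d) := by
  conv_lhs => rw [f_eq hd]
  rw [← mul_assoc, mul_sub, mul_one, mul_inv_cancel₀ x_ne_zero]

/-- This is the functional equation for a reduced fraction `p / q`. Coprimality makes `q(x^d)`
divide `(x - 1) q`, so `d * deg q ≤ deg q + 1`: either `q` is constant, or `deg q = 1` and `d = 2`.
-/
theorem X_mul_mul_expand_ne {d : ℕ} (hd : 2 ≤ d) {p q : ℚ[X]} (hp : p ≠ 0) (hq : q ≠ 0)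
    (hpq : IsCoprime p q) : X * p * expand ℚ d q ≠ (X - 1) * expand ℚ d p * q := by
  intro h
  have hX : (X - 1 : ℚ[X]) ≠ 0 := X_sub_C_ne_zero 1
  have hX1 : (X - 1 : ℚ[X]).natDegree = 1 := natDegree_X_sub_C 1
  have hco : IsCoprime (expand ℚ d q) (expand ℚ d p) :=
    (isCoprime_expand (by omega)).2 hpq.symm
  obtain ⟨r, hr⟩ : expand ℚ d q ∣ (X - 1) * q :=
    hco.dvd_of_dvd_mul_left ⟨X * p, by linear_combination -h⟩
  have hq' : expand ℚ d q ≠ 0 := (expand_ne_zero (by omega)).2 hq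
  have hr0 : r ≠ 0 := by
    rintro rfl
    rw [mul_zero] at hr
    exact mul_ne_zero hX hq hr
  have hdeg := congrArg natDegree hr
  rw [natDegree_mul hX hq, natDegree_mul hq' hr0, natDegree_expand, hX1] at hdeg
  have hle : q.natDegree * 2 ≤ q.natDegree * d := Nat.mul_le_mul_left _ hd
  rcases Nat.eq_zero_or_pos q.natDegree with h0 | hpos
  -- With `q` constant, degrees force `p` to be constant too, and the equation fails at `0`.
  · have hdeg' := congrArg natDegree h
    have hp' : expand ℚ d p ≠ 0 := (expand_ne_zero (by omega)).2 hp
    rw [natDegree_mul (mul_ne_zero X_ne_zero hp) hq', natDegree_mul X_ne_zero hp,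
      natDegree_mul (mul_ne_zero hX hp') hq, natDegree_mul hX hp', natDegree_expand,
      natDegree_expand, h0, hX1, natDegree_X] at hdeg'
    have hlep : p.natDegree * 2 ≤ p.natDegree * d := Nat.mul_le_mul_left _ hd
    have hp0 : p.natDegree = 0 := by omega
    rw [eq_C_of_natDegree_eq_zero h0, eq_C_of_natDegree_eq_zero hp0] at h
    have h1 := congrArg (eval 0) h
    rw [eq_C_of_natDegree_eq_zero h0, C_ne_zero] at hq
    rw [eq_C_of_natDegree_eq_zero hp0, C_ne_zero] at hp
    simp [hp, hq] at h1
  · have hq1 : q.natDegree = 1 := by omega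
    have hd2 : d = 2 := by rw [hq1] at hdeg; omega
    have hr' : r.natDegree = 0 := by rw [hq1] at hdeg; omega
    subst hd2
    rw [eq_C_of_natDegree_eq_zero hr'] at hr hr0
    rw [C_ne_zero] at hr0
    -- Now `(x - 1) q` is a nonzero scalar times `q(x²)`; evaluating at `1` and `-1` gives the
    -- linear `q` two roots.
    have h1 := congrArg (eval 1) hr
    have h2 := congrArg (eval (-1)) hr
    simp [expand_eval, hr0] at h1 h2
    rw [h1] at h2
    rw [eq_X_add_C_of_natDegree_le_one hq1.le] at h1 h2 hq
    simp at h1 h2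
    norm_num at h2
    have ha : q.coeff 0 = 0 := by linarith
    have hb : q.coeff 1 = 0 := by linarith
    simp [ha, hb] at hq

theorem isIrrational_f {d : ℕ} (hd : 2 ≤ d) : IsIrrational (f d) := by
  intro p q hq hpq
  have hd0 : 0 < d := by omega
  have hp : p ≠ 0 := by
    rintro rfl
    rw [map_zero] at hpq
    exact mul_ne_zero (f_ne_zero hd) (ofPoly_ne_zero hq) hpq
  -- The given `p / q` need not be reduced, so it is replaced by its reduced form.
  set r : RatFunc ℚ := algebraMap ℚ[X] (RatFunc ℚ) p / algebraMap ℚ[X] (RatFunc ℚ) q with hr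
  have hrpq : r.num * q = p * r.denom := (RatFunc.num_mul_eq_mul_denom_iff hq).2 hr
  have hnum : r.num ≠ 0 := by
    intro h
    rw [h, zero_mul] at hrpq
    exact mul_ne_zero hp r.denom_ne_zero hrpq.symm
  have hf : f d * ofPoly r.denom = ofPoly r.num := by
    apply mul_right_cancel₀ (ofPoly_ne_zero hq)
    rw [← map_mul, hrpq, map_mul, ← hpq]
    ring
  have hf' : substPow d hd0 (f d) * ofPoly (expand ℚ d r.denom) =
      ofPoly (expand ℚ d r.num) := by
    rw [← substPow_ofPoly hd0, ← substPow_ofPoly hd0, ← map_mul, hf]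
  refine X_mul_mul_expand_ne hd hnum r.denom_ne_zero r.isCoprime_num_denom
    (ofPoly_injective ?_)
  simp only [map_mul, map_sub, map_one, ofPoly_X]
  rw [← hf, ← hf']
  linear_combination ofPoly r.denom * ofPoly (expand ℚ d r.denom) * x_mul_f hd

/-! ## The series `g`, `h` and `u` -/

theorem X_sub_one_ne_zero : (X - 1 : ℚ[X]) ≠ 0 := X_sub_C_ne_zero 1

theorem natDegree_X_sub_one : (X - 1 : ℚ[X]).natDegree = 1 := natDegree_X_sub_C 1

theorem X_sub_one_dvd_iff {p : ℚ[X]} : (X - 1) ∣ p ↔ p.eval 1 = 0 :=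
  dvd_iff_isRoot (a := 1)

theorem ofPoly_X_sub_one : ofPoly (X - 1) = x - 1 := by
  rw [map_sub, map_one, ofPoly_X]

theorem order_x_sub_one : (x - 1).order = -1 := by
  rw [← ofPoly_X_sub_one, order_ofPoly X_sub_one_ne_zero, natDegree_X_sub_one, Nat.cast_one]

theorem x_sub_one_ne_zero : x - 1 ≠ 0 := by
  rw [← ofPoly_X_sub_one]
  exact ofPoly_ne_zero X_sub_one_ne_zero

theorem IsIrrational.of_mul_eq_mul {v w : Series} (hv : IsIrrational v) {a b : ℚ[X]} (ha : a ≠ 0)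
    (h : ofPoly b * w = ofPoly a * v) : IsIrrational w := by
  intro p q hq hpq
  refine hv (b * p) (a * q) (mul_ne_zero ha hq) ?_
  rw [map_mul, map_mul, ← hpq]
  linear_combination -ofPoly q * h

theorem isIrrational_h {d : ℕ} (hd : 2 ≤ d) : IsIrrational (h d) := by
  refine (isIrrational_f hd).of_mul_eq_mul (a := 1) (b := X) one_ne_zero ?_
  rw [ofPoly_X, h, mul_inv_cancel_left₀ x_ne_zero, map_one, one_mul]

theorem u_eq (d : ℕ) : u d = (x - 1) * h d := by
  rw [u, h, sub_mul x, ← mul_assoc, mul_inv_cancel₀ x_ne_zero]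
  ring

theorem isIrrational_u {d : ℕ} (hd : 2 ≤ d) : IsIrrational (u d) := by
  refine (isIrrational_h hd).of_mul_eq_mul (a := X - 1) (b := 1) X_sub_one_ne_zero ?_
  rw [u_eq, map_one, one_mul, map_sub, map_one, ofPoly_X]

theorem x_pow_mul_g (d : ℕ) : x ^ d * g d = x * f d := by
  rw [g, ← mul_assoc, ← zpow_natCast, ← zpow_add₀ x_ne_zero, add_neg_cancel_left, zpow_one]

theorem isIrrational_g {d : ℕ} (hd : 2 ≤ d) : IsIrrational (g d) := by
  refine (isIrrational_f hd).of_mul_eq_mul (a := X) (b := X ^ d) X_ne_zero ?_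
  rw [map_pow, ofPoly_X, x_pow_mul_g d]

theorem g_eq_mul_substPow_h {d : ℕ} (hd : 2 ≤ d) :
    g d = (x - 1) * substPow d (by omega) (h d) := by
  apply mul_left_cancel₀ (pow_ne_zero d x_ne_zero)
  rw [x_pow_mul_g d, x_mul_f hd, h, map_mul, map_inv₀, substPow_x, mul_left_comm (x ^ d),
    mul_inv_cancel_left₀ (pow_ne_zero d x_ne_zero)]

theorem geom_sum_mul_g {d : ℕ} (hd : 2 ≤ d) :
    ofPoly (∑ i ∈ Finset.range d, X ^ i) * g d = substPow d (by omega) (u d) := by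
  have h1 : ofPoly (∑ i ∈ Finset.range d, X ^ i) * (x - 1) = x ^ d - 1 := by
    have := congrArg ofPoly (geom_sum_mul (X : ℚ[X]) d)
    simpa only [map_mul, map_sub, map_pow, map_one, ofPoly_X] using this
  rw [g_eq_mul_substPow_h hd, ← mul_assoc, h1, u_eq, map_mul, map_sub, map_one, substPow_x]

theorem order_h {d : ℕ} (hd : 2 ≤ d) : (h d).order = 1 := by
  rw [h, HahnSeries.order_mul (inv_ne_zero x_ne_zero) (f_ne_zero hd), order_inv, order_x,
    order_f hd]
  rfl

theorem order_g_pos {d : ℕ} (hd : 2 ≤ d) : 0 < (g d).order := by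
  rw [g_eq_mul_substPow_h hd, HahnSeries.order_mul x_sub_one_ne_zero
    ((_root_.map_ne_zero _).2 (isIrrational_h hd).ne_zero), order_x_sub_one,
    order_substPow _ (isIrrational_h hd).ne_zero, order_h hd]
  omega

theorem natDegree_geom_sum {d : ℕ} (hd : 2 ≤ d) :
    (∑ i ∈ Finset.range d, X ^ i : ℚ[X]) ≠ 0 ∧
      (∑ i ∈ Finset.range d, X ^ i : ℚ[X]).natDegree + 1 = d := by
  have h1 := geom_sum_mul (X : ℚ[X]) d
  have h2 : (X ^ d - 1 : ℚ[X]).natDegree = d := natDegree_X_pow_sub_C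
  have h0 : (∑ i ∈ Finset.range d, X ^ i : ℚ[X]) ≠ 0 := by
    intro h0
    rw [← h1, h0, zero_mul, natDegree_zero] at h2
    omega
  refine ⟨h0, ?_⟩
  rw [← h1, natDegree_mul h0 X_sub_one_ne_zero, natDegree_X_sub_one] at h2
  exact h2

/-! ## Passing between convergents of `v` and of `(x - 1) v` -/

theorem natDegree_sub_convDen {v : Series} (hv : IsIrrational v) (t : ℕ) {a : ℚ} (ha : a ≠ 0)
    (b : ℚ) : (C a * convDen v (t + 1) - C b * convDen v t).natDegree =
      (convDen v (t + 1)).natDegree := by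
  rw [natDegree_sub_eq_left_of_natDegree_lt, natDegree_C_mul ha]
  rw [natDegree_C_mul ha]
  exact (natDegree_C_mul_le _ _).trans_lt (strictMono_natDegree_convDen hv t.lt_succ_self)

theorem sub_convDen_ne_zero {v : Series} (hv : IsIrrational v) (t : ℕ) {a : ℚ} (ha : a ≠ 0)
    (b : ℚ) : C a * convDen v (t + 1) - C b * convDen v t ≠ 0 := by
  intro h
  have h1 := natDegree_sub_convDen hv t ha b
  have h2 : (convDen v t).natDegree < (convDen v (t + 1)).natDegree :=
    strictMono_natDegree_convDen hv t.lt_succ_self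
  rw [h, natDegree_zero] at h1
  omega

/-- The older error, of order `deg qₜ₊₁`, dominates unless `b = 0`. The bound is one short of the
strict inequality that the approximation criterion requires; the factor `x - 1` will supply the
missing degree. -/
theorem natDegree_le_order_sub_convDen {v : Series} (hv : IsIrrational v) (t : ℕ) {a : ℚ}
    (ha : a ≠ 0) (b : ℚ) : ((convDen v (t + 1)).natDegree : ℤ) ≤
      (v * ofPoly (C a * convDen v (t + 1) - C b * convDen v t) -
        ofPoly (C a * convNum v (t + 1) - C b * convNum v t)).order := by
  have h0 := hv.sub_ne_zero (sub_convDen_ne_zero hv t ha b)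
    (C a * convNum v (t + 1) - C b * convNum v t)
  have herr : v * ofPoly (C a * convDen v (t + 1) - C b * convDen v t) -
        ofPoly (C a * convNum v (t + 1) - C b * convNum v t) =
      ofPoly (C a) * (v * ofPoly (convDen v (t + 1)) - ofPoly (convNum v (t + 1))) +
        ofPoly (C (-b)) * (v * ofPoly (convDen v t) - ofPoly (convNum v t)) := by
    simp only [map_sub, map_mul, map_neg]
    ring
  have hC (e : ℚ) (r : Series) (he : e ≠ 0) (hr : r ≠ 0) :
      (ofPoly (C e) * r).order = r.order := by
    rw [HahnSeries.order_mul (ofPoly_ne_zero (C_ne_zero.2 he)) hr,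
      order_ofPoly (C_ne_zero.2 he), natDegree_C, Nat.cast_zero, neg_zero, zero_add]
  have hlt : (convDen v (t + 1)).natDegree < (convDen v (t + 1 + 1)).natDegree :=
    strictMono_natDegree_convDen hv (t + 1).lt_succ_self
  have h1 := hC a _ ha (hv.sub_ne_zero (convDen_ne_zero v (t + 1)) (convNum v (t + 1)))
  rw [order_mul_convDen_sub hv] at h1
  rw [herr] at h0 ⊢
  rcases eq_or_ne b 0 with rfl | hb
  · rw [neg_zero, map_zero, map_zero, zero_mul, add_zero, h1]
    omega
  · rw [← Int.sub_one_lt_iff]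
    apply lt_order_add h0
    · rw [h1]
      omega
    · rw [hC _ _ (neg_ne_zero.2 hb) (hv.sub_ne_zero (convDen_ne_zero v t) _),
        order_mul_convDen_sub hv]
      omega

/-- A single identity serves twice: divided by `c` it is a Bézout relation, and at `1` its second
term vanishes. -/
theorem isCoprime_and_not_dvd_of_eq_C {p q r s : ℚ[X]} {c : ℚ} (hc : c ≠ 0)
    (h : p * r - q * ((X - 1) * s) = C c) : IsCoprime p q ∧ ¬ (X - 1) ∣ p := by
  constructor
  · refine ⟨C c⁻¹ * r, -C c⁻¹ * ((X - 1) * s), ?_⟩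
    have h1 : C c⁻¹ * C c = 1 := by rw [← map_mul, inv_mul_cancel₀ hc, map_one]
    linear_combination C c⁻¹ * h + h1
  · rw [X_sub_one_dvd_iff]
    intro hp
    have := congrArg (eval 1) h
    simp [hp, hc.symm] at this

/-- A convergent of `v` whose denominator does not vanish at `1` produces a convergent of
`(x - 1) v` whose numerator does not vanish at `1`. -/
theorem exists_convergent_of_not_dvd_convDen {v w : Series} (hv : IsIrrational v)
    (hw : IsIrrational w) (hwv : w = (x - 1) * v) {t : ℕ} (ht : ¬ (X - 1) ∣ convDen v t) :
    ∃ s, (convDen w s).natDegree + 1 = (convDen v (t + 1)).natDegree ∧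
      ¬ (X - 1) ∣ convNum w s := by
  rw [X_sub_one_dvd_iff] at ht
  obtain ⟨c, hc, hdet⟩ := convNum_mul_convDen_sub hv t
  -- These weights make the combined denominator vanish at `1`; `a ≠ 0` keeps its degree equal to
  -- that of `convDen v (t + 1)`.
  set a := (convDen v t).eval 1
  set b := (convDen v (t + 1)).eval 1
  have hdeg := natDegree_sub_convDen hv t ht b
  have hne := sub_convDen_ne_zero hv t ht b
  have hord := natDegree_le_order_sub_convDen hv t ht b
  set p := C a * convNum v (t + 1) - C b * convNum v t with hp
  obtain ⟨q, hq⟩ : (X - 1) ∣ C a * convDen v (t + 1) - C b * convDen v t := by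
    rw [X_sub_one_dvd_iff]
    simp only [eval_sub, eval_mul, eval_C]
    ring
  -- The terms in `b` cancel, leaving `a` times the determinant of consecutive convergents.
  have hbez : p * convDen v t - q * ((X - 1) * convNum v t) = C (a * c) := by
    rw [map_mul, ← hdet, hp]
    linear_combination convNum v t * hq
  rw [hq] at hdeg hne hord
  have hq0 : q ≠ 0 := right_ne_zero_of_mul hne
  rw [natDegree_mul X_sub_one_ne_zero hq0, natDegree_X_sub_one] at hdeg
  obtain ⟨hco, hp1⟩ := isCoprime_and_not_dvd_of_eq_C (mul_ne_zero ht hc) hbez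
  have herr : v * ofPoly ((X - 1) * q) - ofPoly p = w * ofPoly q - ofPoly p := by
    rw [hwv, map_mul, ofPoly_X_sub_one]
    ring
  rw [herr] at hord
  obtain ⟨s, hs, hsn, -⟩ := exists_convNum_convDen_associated hw hq0 (by omega) hco
  exact ⟨s, by omega, fun h => hp1 (h.trans hsn)⟩

/-- A convergent of `(x - 1) v` whose numerator does not vanish at `1` produces a convergent of
`v` whose denominator does not vanish at `1`. -/
theorem exists_convergent_of_not_dvd_convNum {v w : Series} (hv : IsIrrational v)
    (hw : IsIrrational w) (hwv : w = (x - 1) * v) {t : ℕ} (ht : ¬ (X - 1) ∣ convNum w t) :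
    ∃ s, (convDen v s).natDegree = (convDen w (t + 1)).natDegree ∧
      ¬ (X - 1) ∣ convDen v s := by
  rw [X_sub_one_dvd_iff] at ht
  obtain ⟨c, hc, hdet⟩ := convNum_mul_convDen_sub hw t
  set a := (convNum w t).eval 1
  set b := (convNum w (t + 1)).eval 1
  have hdeg := natDegree_sub_convDen hw t ht b
  have hne := sub_convDen_ne_zero hw t ht b
  have hord := natDegree_le_order_sub_convDen hw t ht b
  set q := C a * convDen w (t + 1) - C b * convDen w t with hq
  obtain ⟨p, hp⟩ : (X - 1) ∣ C a * convNum w (t + 1) - C b * convNum w t := by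
    rw [X_sub_one_dvd_iff]
    simp only [eval_sub, eval_mul, eval_C]
    ring
  have hbez : q * convNum w t - p * ((X - 1) * convDen w t) = C (-(a * c)) := by
    rw [map_neg, map_mul, ← hdet, hq]
    linear_combination convDen w t * hp
  obtain ⟨hco, hq1⟩ := isCoprime_and_not_dvd_of_eq_C (neg_ne_zero.2 (mul_ne_zero ht hc)) hbez
  have herr : w * ofPoly q - ofPoly ((X - 1) * p) = (x - 1) * (v * ofPoly q - ofPoly p) := by
    rw [hwv, map_mul, ofPoly_X_sub_one]
    ring
  -- Removing `x - 1` from the error raises its order by one, which makes the criterion's inequality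
  -- strict.
  rw [hp, herr, HahnSeries.order_mul x_sub_one_ne_zero (hv.sub_ne_zero hne _),
    order_x_sub_one] at hord
  obtain ⟨s, hs, -, hsd⟩ := exists_convNum_convDen_associated hv hne (by omega) hco.symm
  exact ⟨s, by omega, fun h => hq1 (h.trans hsd)⟩

/-! ## The convergents of `g` -/

/-- Scaling `p` and `q` by a common polynomial raises `deg q` and lowers the order equally, so the
sum can be computed from any representation, reduced or not. It yields the next denominator's
degree. -/
theorem natDegree_add_order_eq {w : Series} (hw : IsIrrational w) {p q : ℚ[X]} (hq : q ≠ 0)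
    {n : ℕ} (hn : convergent w n =
      algebraMap ℚ[X] (RatFunc ℚ) p / algebraMap ℚ[X] (RatFunc ℚ) q) :
    (q.natDegree : ℤ) + (w * ofPoly q - ofPoly p).order =
      (convDen w n).natDegree + (convDen w (n + 1)).natDegree := by
  have heq : convNum w n * q = p * convDen w n := (RatFunc.num_mul_eq_mul_denom_iff hq).2 hn
  have hd := convDen_ne_zero w n
  have h : ofPoly (convDen w n) * (w * ofPoly q - ofPoly p) =
      ofPoly q * (w * ofPoly (convDen w n) - ofPoly (convNum w n)) := by
    have := congrArg ofPoly heq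
    simp only [map_mul] at this
    linear_combination this
  have := congrArg HahnSeries.order h
  rw [HahnSeries.order_mul (ofPoly_ne_zero hd) (hw.sub_ne_zero hq _),
    HahnSeries.order_mul (ofPoly_ne_zero hq) (hw.sub_ne_zero hd _), order_ofPoly hq,
    order_ofPoly hd, order_mul_convDen_sub hw] at this
  omega

theorem order_g_sub_of_h {d : ℕ} (hd : 2 ≤ d) (t : ℕ) :
    (g d * ofPoly (expand ℚ d (convDen (h d) t)) -
      ofPoly ((X - 1) * expand ℚ d (convNum (h d) t))).order =
        d * (convDen (h d) (t + 1)).natDegree - 1 := by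
  have hd0 : 0 < d := by omega
  have hne := (isIrrational_h hd).sub_ne_zero (convDen_ne_zero (h d) t) (convNum (h d) t)
  have : g d * ofPoly (expand ℚ d (convDen (h d) t)) -
      ofPoly ((X - 1) * expand ℚ d (convNum (h d) t)) = (x - 1) *
        substPow d hd0 (h d * ofPoly (convDen (h d) t) - ofPoly (convNum (h d) t)) := by
    rw [g_eq_mul_substPow_h hd, map_sub (substPow d hd0), map_mul (substPow d hd0),
      substPow_ofPoly, substPow_ofPoly, map_mul, map_sub, map_one, ofPoly_X]
    ring
  rw [this, HahnSeries.order_mul x_sub_one_ne_zero ((_root_.map_ne_zero _).2 hne),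
    order_substPow hd0 hne, order_x_sub_one, order_mul_convDen_sub (isIrrational_h hd)]
  ring

theorem order_g_sub_of_u {d : ℕ} (hd : 2 ≤ d) (t : ℕ) :
    (g d * ofPoly ((∑ i ∈ Finset.range d, X ^ i) * expand ℚ d (convDen (u d) t)) -
      ofPoly (expand ℚ d (convNum (u d) t))).order =
        d * (convDen (u d) (t + 1)).natDegree := by
  have hd0 : 0 < d := by omega
  have hne := (isIrrational_u hd).sub_ne_zero (convDen_ne_zero (u d) t) (convNum (u d) t)
  have : g d * ofPoly ((∑ i ∈ Finset.range d, X ^ i) * expand ℚ d (convDen (u d) t)) -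
      ofPoly (expand ℚ d (convNum (u d) t)) =
        substPow d hd0 (u d * ofPoly (convDen (u d) t) - ofPoly (convNum (u d) t)) := by
    rw [map_sub (substPow d hd0), map_mul (substPow d hd0), ← geom_sum_mul_g hd,
      substPow_ofPoly, substPow_ofPoly, map_mul ofPoly]
    ring
  rw [this, order_substPow hd0 hne, order_mul_convDen_sub (isIrrational_u hd)]

/-- The `m`-th convergent of `g` is the one obtained from the `t`-th convergent of `h`, and the
latter stays reduced under this construction. -/
def IsFromH (d m t : ℕ) : Prop :=
  convergent (g d) m =
      algebraMap ℚ[X] (RatFunc ℚ) ((X - 1) * expand ℚ d (convNum (h d) t)) /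
        algebraMap ℚ[X] (RatFunc ℚ) (expand ℚ d (convDen (h d) t)) ∧
    ¬ (X - 1) ∣ convDen (h d) t ∧
    (convDen (g d) m).natDegree = d * (convDen (h d) t).natDegree

/-- The `m`-th convergent of `g` is the one obtained from the `t`-th convergent of `u`, and the
latter stays reduced under this construction. -/
def IsFromU (d m t : ℕ) : Prop :=
  convergent (g d) m =
      algebraMap ℚ[X] (RatFunc ℚ) (expand ℚ d (convNum (u d) t)) /
        algebraMap ℚ[X] (RatFunc ℚ)
          ((∑ i ∈ Finset.range d, X ^ i) * expand ℚ d (convDen (u d) t)) ∧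
    ¬ (X - 1) ∣ convNum (u d) t ∧
    (convDen (g d) m).natDegree + 1 = d * (convDen (u d) t).natDegree + d

theorem isFromH_zero {d : ℕ} (hd : 2 ≤ d) : IsFromH d 0 0 := by
  have hconv (w : Series) (hw : 0 < w.order) : convergent w 0 = 0 := by
    rw [convergent, GenContFract.zeroth_conv_eq_h]
    change algebraMap ℚ[X] (RatFunc ℚ) (polyPart w) = 0
    rw [polyPart_eq_zero hw, map_zero]
  have hg := hconv (g d) (order_g_pos hd)
  have hh := hconv (h d) (by rw [order_h hd]; exact one_pos)
  have h1 : convDen (h d) 0 = 1 := by rw [convDen, hh, RatFunc.denom_zero]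
  refine ⟨?_, ?_, ?_⟩
  · rw [hg, convNum, hh, RatFunc.num_zero, map_zero, mul_zero, map_zero, zero_div]
  · rw [h1, X_sub_one_dvd_iff, eval_one]
    exact one_ne_zero
  · rw [natDegree_convDen_zero (isIrrational_g hd), natDegree_convDen_zero (isIrrational_h hd),
      mul_zero]

/-- The index `m + 1` is identified by degree alone: the known error fixes `deg q_{m+1,g}`, and the
fraction built from `u` has that same degree. -/
theorem IsFromH.exists_isFromU_succ {d m t : ℕ} (hd : 2 ≤ d) (ht : IsFromH d m t) :
    ∃ s, IsFromU d (m + 1) s := by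
  obtain ⟨hconv, hdvd, hdeg⟩ := ht
  have hg := isIrrational_g hd
  have hu := isIrrational_u hd
  have hsum := natDegree_add_order_eq hg
    ((expand_ne_zero (by omega)).2 (convDen_ne_zero (h d) t)) hconv
  rw [order_g_sub_of_h hd, natDegree_expand, hdeg] at hsum
  obtain ⟨s, hs, hsdvd⟩ := exists_convergent_of_not_dvd_convDen (isIrrational_h hd) hu (u_eq d) hdvd
  rw [← hs] at hsum
  push_cast at hsum
  have hdeg' : (convDen (g d) (m + 1)).natDegree + 1 = d * (convDen (u d) s).natDegree + d := by
    zify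
    linear_combination -hsum
  obtain ⟨hgeom, hgdeg⟩ := natDegree_geom_sum hd
  have hexp : expand ℚ d (convDen (u d) s) ≠ 0 :=
    (expand_ne_zero (by omega)).2 (convDen_ne_zero (u d) s)
  have hQdeg : ((∑ i ∈ Finset.range d, X ^ i) * expand ℚ d (convDen (u d) s)).natDegree =
      (convDen (g d) (m + 1)).natDegree := by
    rw [natDegree_mul hgeom hexp, natDegree_expand, mul_comm _ d]
    omega
  refine ⟨s, convergent_eq_of_lt_order hg (mul_ne_zero hgeom hexp) ?_ hQdeg.ge ?_, hsdvd, hdeg'⟩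
  -- The order exceeds the degree with nothing to spare: one step in `u` adds at least `d`, while
  -- the geometric sum costs `d - 1`.
  · have hlt : (convDen (u d) s).natDegree + 1 ≤ (convDen (u d) (s + 1)).natDegree :=
      strictMono_natDegree_convDen hu s.lt_succ_self
    have := Nat.mul_le_mul_left d hlt
    rw [mul_add, mul_one] at this
    rw [order_g_sub_of_u hd, hQdeg]
    zify at this hdeg'
    omega
  · rw [hQdeg]
    exact strictMono_natDegree_convDen hg (m + 1).lt_succ_self

theorem IsFromU.exists_isFromH_succ {d m t : ℕ} (hd : 2 ≤ d) (ht : IsFromU d m t) :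
    ∃ s, IsFromH d (m + 1) s := by
  obtain ⟨hconv, hdvd, hdeg⟩ := ht
  have hg := isIrrational_g hd
  have hh := isIrrational_h hd
  obtain ⟨hgeom, hgdeg⟩ := natDegree_geom_sum hd
  have hexp : expand ℚ d (convDen (u d) t) ≠ 0 :=
    (expand_ne_zero (by omega)).2 (convDen_ne_zero (u d) t)
  have hsum := natDegree_add_order_eq hg (mul_ne_zero hgeom hexp) hconv
  rw [order_g_sub_of_u hd, natDegree_mul hgeom hexp, natDegree_expand] at hsum
  obtain ⟨s, hs, hsdvd⟩ := exists_convergent_of_not_dvd_convNum hh (isIrrational_u hd) (u_eq d) hdvd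
  rw [← hs] at hsum
  push_cast at hsum
  have hdeg' : (convDen (g d) (m + 1)).natDegree = d * (convDen (h d) s).natDegree := by
    zify at hdeg hgdeg ⊢
    linear_combination -hsum - hdeg + hgdeg
  have hQdeg : (expand ℚ d (convDen (h d) s)).natDegree =
      (convDen (g d) (m + 1)).natDegree := by
    rw [natDegree_expand, hdeg', mul_comm]
  refine ⟨s, convergent_eq_of_lt_order hg ((expand_ne_zero (by omega)).2 (convDen_ne_zero _ s))
    ?_ hQdeg.ge ?_, hsdvd, hdeg'⟩
  -- One step in `h` adds at least `d` and the factor `x - 1` costs `1`, so the margin is `d - 1`,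
  -- positive because `2 ≤ d`.
  · have hlt : (convDen (h d) s).natDegree + 1 ≤ (convDen (h d) (s + 1)).natDegree :=
      strictMono_natDegree_convDen hh s.lt_succ_self
    have := Nat.mul_le_mul_left d hlt
    rw [mul_add, mul_one] at this
    rw [order_g_sub_of_h hd, hQdeg]
    zify at this hdeg' hd
    omega
  · rw [hQdeg]
    exact strictMono_natDegree_convDen hg (m + 1).lt_succ_self

theorem exists_isFromU_or_isFromH {d : ℕ} (hd : 2 ≤ d) (m : ℕ) :
    (Odd m → ∃ t, IsFromU d m t) ∧ (Even m → ∃ t, IsFromH d m t) := by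
  induction m with
  | zero => exact ⟨fun h => absurd h (by decide), fun _ => ⟨0, isFromH_zero hd⟩⟩
  | succ m ih =>
    constructor
    · intro hm
      obtain ⟨t, ht⟩ := ih.2 (by simpa [Nat.odd_add_one] using hm)
      exact ht.exists_isFromU_succ hd
    · intro hm
      obtain ⟨t, ht⟩ := ih.1 (by simpa [Nat.even_add_one] using hm)
      exact ht.exists_isFromH_succ hd

end ThueMorseCF

end

theorem theorem1 (d : ℕ) (hd : 2 ≤ d) (m : ℕ) :
    (Odd m → ∃ t : ℕ,
      ThueMorseCF.convergent (ThueMorseCF.g d) m =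
          algebraMap (Polynomial ℚ) (RatFunc ℚ)
              (Polynomial.expand ℚ d (ThueMorseCF.convNum (ThueMorseCF.u d) t)) /
            algebraMap (Polynomial ℚ) (RatFunc ℚ)
              ((∑ i ∈ Finset.range d, Polynomial.X ^ i) *
                Polynomial.expand ℚ d (ThueMorseCF.convDen (ThueMorseCF.u d) t)) ∧
        ¬ (Polynomial.X - 1 : Polynomial ℚ) ∣ ThueMorseCF.convNum (ThueMorseCF.u d) t) ∧
    (Even m → ∃ t : ℕ,
      ThueMorseCF.convergent (ThueMorseCF.g d) m =
          algebraMap (Polynomial ℚ) (RatFunc ℚ)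
              ((Polynomial.X - 1) *
                Polynomial.expand ℚ d (ThueMorseCF.convNum (ThueMorseCF.h d) t)) /
            algebraMap (Polynomial ℚ) (RatFunc ℚ)
              (Polynomial.expand ℚ d (ThueMorseCF.convDen (ThueMorseCF.h d) t)) ∧
        ¬ (Polynomial.X - 1 : Polynomial ℚ) ∣ ThueMorseCF.convDen (ThueMorseCF.h d) t) := by
  obtain ⟨hodd, heven⟩ := ThueMorseCF.exists_isFromU_or_isFromH hd m
  refine ⟨fun hm => ?_, fun hm => ?_⟩
  · obtain ⟨t, ht, hdvd, -⟩ := hodd hm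
    exact ⟨t, ht, hdvd⟩
  · obtain ⟨t, ht, hdvd, -⟩ := heven hm
    exact ⟨t, ht, hdvd⟩
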